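/- **Setting.** Let $x=(x^1,\dots,x^n)$ and $(x,u)$ be adapted local coordinates of a bundle $E\to M$ with one-dimensional fibres over an $n$-dimensional base, and let $x,\ u,\ \lambda_{j_1\cdots j_k}$ ($1\le k\le r$, symmetric in the subscripts) be the corresponding coordinates of the bundle $J^rE$ of $r$-jets of sections. Let $W$ be an open subset of this coordinate space. By a section of $E$ we mean a smooth function $u$ on an open set $D\subset\mathbb R^n$ whose lift $j^ru:\ x\mapsto (x,u(x),\lambda_{j_1\cdots j_k}=u_{j_1\cdots j_k}(x))$ takes values in $W$. Let $F:J^rE\to\mathbb R$ be a function; $u$ is a solution of the equation $F(x,u,\lambda_j,\lambda_{jk},\dots)=0$ if $F(j^ru(x))=0$ for all $x\in D$. Let $G$ be a finite-dimensional Lie group, let $e_A$ be a basis of its Lie algebra $\mathfrak g$ with dual left-invariant forms $w^A$, and let $C^A_{BC}$ be the structure constants, $dw^A=\tfrac12 C^A_{BC}\,w^B\wedge w^C$. Let $\pi:P\to W$ be a smooth principal $G$-bundle with a connection, given by a $\mathfrak g$-valued connection form with components $\tilde\omega^A$, and let $$\Omega^A=d\tilde\omega^A-\tfrac12 C^A_{BC}\,\tilde\omega^B\wedge\tilde\omega^C$$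 be its curvature forms. For a section $u$ over $D$ let $P_u=\pi^{-1}(j^ru(D))\subset P$. Assume that the connection determines a representation of zero curvature for the equation $F=0$: for every section $u$, the restrictions of all $\Omega^A$ to $P_u$ vanish if and only if $u$ is a solution. Let a representation of $G$ by transformations of an $N$-dimensional fibre, with coordinates $X=(X^1,\dots,X^N)$ ranging over an open set $Y\subset\mathbb R^N$, be specified by the Pfaffian system $dX^I-\xi^I_A(X)\,w^A=0$, where the $\xi^I_A$ are smooth functions on $Y$ that satisfy the Lie identities $$\xi_B^K\frac{\partial \xi_C^I}{\partial X^K}-\xi_C^K\frac{\partial \xi_B^I}{\partial X^K}+\xi_A^I C^A_{BC}=0 .$$ The connection induced in the associated bundle has the connection forms $$\tilde\theta^I=dX^I-\xi^I_A(X)\,\tilde\omega^A,\qquad I=1,\dots,N,$$ written as forms on $P\times Y$. The system $\tilde\theta^1,\dots,\tilde\theta^N$ is called completely integrable on the pull-back of a section $u$ if on $P_u\times Y$ one has $d\tilde\theta^I=\sum_K\tilde\theta^K\wedge\eta^I_K$ for some smooth one-forms $\eta^I_K$ defined on a neighbourhood of $P_u\times Y$ in $P\times Y$. **Corollary 4.1.**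 (i) The system $\tilde\theta^I$ is completely integrable on the pull-back of every section $u$ that is a solution of the equation $F=0$. (ii) Suppose that the representation is effective up to a discrete kernel, i.e. that the vector fields $\xi_A=\xi_A^I\,\partial/\partial X^I$ on $Y$ are linearly independent over $\mathbb R$. Then the system $\tilde\theta^I$ is completely integrable on the pull-back of a section $u$ if and only if $u$ is a solution of $F=0$. -/

import Mathlib

open scoped Manifold ContDiff

noncomputable section

namespace ZeroCurvature

/-! ### Jets of sections, partial differential equations

`M` is described by the coordinates `x¹, …, xⁿ`, the bundle `E → M` with one-dimensional fibres by
the adapted coordinates `(x, u)`, and `JʳE` by the coordinates `x`, `u`, `λ_{j₁…j_k}`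
(`1 ≤ k ≤ r`), symmetric in the subscripts. -/

/-- The index set of the fibre coordinates of `JʳE → M`: unordered tuples `{j₁, …, j_k}` with
`k ≤ r`.  The empty tuple is the index of the coordinate `u` itself. -/
abbrev JetIndex (n r : ℕ) : Type := Σ k : Fin (r + 1), Sym (Fin n) (k : ℕ)

/-- The coordinate space of `r`-jets of sections: pairs `(x, λ)`. -/
abbrev Jet (n r : ℕ) : Type := (Fin n → ℝ) × (JetIndex n r → ℝ)

/-- The iterated partial derivative `∂_{i₁} ⋯ ∂_{i_k} u`, for `l = [i₁, …, i_k]`. -/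
def iterPartial {n : ℕ} (l : List (Fin n)) (u : (Fin n → ℝ) → ℝ) : (Fin n → ℝ) → ℝ :=
  l.foldr (fun i f x => fderiv ℝ f x (Pi.single i 1)) u

/-- The lift `x ↦ (x, u(x), u_{i₁…i_k}(x))` of the section `u = u(x¹, …, xⁿ)` to `JʳE`.
The subscripts are taken in increasing order; for smooth `u` the order does not matter. -/
def jetLift {n : ℕ} (r : ℕ) (u : (Fin n → ℝ) → ℝ) (x : Fin n → ℝ) : Jet n r :=
  (x, fun s => iterPartial ((s.2 : Multiset (Fin n)).sort (· ≤ ·)) u x)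

/-- `u` is a smooth section over the open set `D`, whose `r`-jets lie in `W ⊆ JʳE`. -/
structure IsSection {n r : ℕ} (W : Set (Jet n r)) (D : Set (Fin n → ℝ))
    (u : (Fin n → ℝ) → ℝ) : Prop where
  isOpen : IsOpen D
  smooth : ContDiffOn ℝ ∞ u D
  mem : ∀ x ∈ D, jetLift r u x ∈ W

/-- `u` solves the equation `F(x, u, u_j, u_{jk}, …) = 0` on `D`. -/
def IsSolution {n r : ℕ} (F : Jet n r → ℝ) (D : Set (Fin n → ℝ)) (u : (Fin n → ℝ) → ℝ) : Prop :=
  ∀ x ∈ D, F (jetLift r u x) = 0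

/-! ### One-forms on manifolds without boundary, exterior derivative, wedge product -/

section Forms

variable {E : Type*} [NormedAddCommGroup E] [NormedSpace ℝ E]
  {H : Type*} [TopologicalSpace H] (I : ModelWithCorners ℝ E H)
  {Q : Type*} [TopologicalSpace Q] [ChartedSpace H Q]
  {V : Type*} [NormedAddCommGroup V] [NormedSpace ℝ V]

/-- `V`-valued one-forms on the manifold `Q` (no smoothness is imposed here). -/
abbrev OneForm (Q : Type*) [TopologicalSpace Q] [ChartedSpace H Q]
    (V : Type*) [NormedAddCommGroup V] [NormedSpace ℝ V] : Type _ :=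
  ∀ q : Q, TangentSpace I q →L[ℝ] V

variable {I}

/-- The expression of a one-form in the chart around `q₀`, i.e. its pull-back under the inverse of
that chart. -/
def OneForm.inChart (α : OneForm I Q V) (q₀ : Q) (y : E) : E →L[ℝ] V :=
  ContinuousLinearMap.comp (α ((extChartAt I q₀).symm y))
    (mfderiv 𝓘(ℝ, E) I (extChartAt I q₀).symm y)

/-- Smoothness of a one-form on an (open) set: its expressions in charts are smooth. -/
def OneForm.SmoothOn (α : OneForm I Q V) (S : Set Q) : Prop :=
  ∀ q₀ : Q, ContDiffOn ℝ ∞ (α.inChart q₀)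
    ((extChartAt I q₀).target ∩ (extChartAt I q₀).symm ⁻¹' S)

/-- The exterior derivative of a one-form, `dα(v, w) = ∂_v(α(w)) - ∂_w(α(v))`, computed in the
chart at `q`, in which a tangent vector at `q` is its own coordinate vector. -/
def OneForm.d (α : OneForm I Q V) (q : Q) (v w : TangentSpace I q) : V :=
  fderiv ℝ (α.inChart q) (extChartAt I q q) v w - fderiv ℝ (α.inChart q) (extChartAt I q q) w v

/-- The wedge product of real one-forms, `(α ∧ β)(v, w) = α(v) β(w) - α(w) β(v)`. -/
def OneForm.wedge (α β : OneForm I Q ℝ) (q : Q) (v w : TangentSpace I q) : ℝ :=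
  α q v * β q w - α q w * β q v

/-- Complete integrability of a Pfaffian system `θ¹, …, θᴺ` on an immersed submanifold, given by
its points `S` and its tangent spaces `T q ⊆ T_q Q`: restricted to the submanifold, every `dθᴵ`
lies in the ideal generated by the system, `dθᴵ = ∑_K θᴷ ∧ η_Kᴵ` with smooth one-forms `η_Kᴵ`
(defined near the submanifold). -/
def CompletelyIntegrableOn {ι : Type*} [Fintype ι] (θ : ι → OneForm I Q ℝ) (S : Set Q)
    (T : ∀ q : Q, Submodule ℝ (TangentSpace I q)) : Prop :=
  ∃ (η : ι → ι → OneForm I Q ℝ) (O : Set Q), IsOpen O ∧ S ⊆ O ∧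
    (∀ a b, (η a b).SmoothOn O) ∧
    ∀ q ∈ S, ∀ v ∈ T q, ∀ w ∈ T q, ∀ b,
      (θ b).d q v w = ∑ a, (θ a).wedge (η a b) q v w

end Forms

/-! ### Principal bundles over (an open part of) the jet bundle, and their connections -/

section Bundles

variable {n r : ℕ}
  {EG : Type*} [NormedAddCommGroup EG] [NormedSpace ℝ EG]
  {HG : Type*} [TopologicalSpace HG] (IG : ModelWithCorners ℝ EG HG)
  {G : Type*} [TopologicalSpace G] [ChartedSpace HG G] [Group G]
  {EP : Type*} [NormedAddCommGroup EP] [NormedSpace ℝ EP]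
  {HP : Type*} [TopologicalSpace HP] (IP : ModelWithCorners ℝ EP HP)
  {P : Type*} [TopologicalSpace P] [ChartedSpace HP P]

/-- A smooth principal bundle `P(W, G)` over the subset `W` of the jet bundle, with structure
group `G` acting on the right. -/
structure PrincipalBundle (W : Set (Jet n r)) (G : Type*) [TopologicalSpace G]
    [ChartedSpace HG G] [Group G] (P : Type*) [TopologicalSpace P] [ChartedSpace HP P] where
  /-- the bundle projection -/
  proj : P → Jet n r
  /-- the right action of the structure group -/
  act : P → G → P
  act_one : ∀ p, act p 1 = p
  act_mul : ∀ p g h, act p (g * h) = act (act p g) h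
  smooth_proj : ContMDiff IP 𝓘(ℝ, Jet n r) ∞ proj
  smooth_act : ContMDiff (IP.prod IG) IP ∞ (fun q : P × G => act q.1 q.2)
  proj_mem : ∀ p, proj p ∈ W
  /-- smooth equivariant local trivializations `U × G ≃ π⁻¹(U)` -/
  locally_trivial : ∀ b ∈ W, ∃ (U : Set (Jet n r))
    (Φ : PartialDiffeomorph ((𝓘(ℝ, Jet n r)).prod IG) IP (Jet n r × G) P ∞),
    IsOpen U ∧ b ∈ U ∧ U ⊆ W ∧ Φ.source = U ×ˢ Set.univ ∧ Φ.target = proj ⁻¹' U ∧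
    (∀ c ∈ U, ∀ g, proj (Φ (c, g)) = c) ∧
    ∀ c ∈ U, ∀ g h, Φ (c, g * h) = act (Φ (c, g)) h

/-- The structure constants `C^A_{BC}` of the Lie group with respect to a basis `e_A` of its Lie
algebra, with the sign for which the dual left-invariant forms satisfy
`dw^A = ½ C^A_{BC} w^B ∧ w^C`, that is `[e_B, e_C] = - C^A_{BC} e_A`. -/
def structureConst {m : ℕ} (e : Module.Basis (Fin m) ℝ (GroupLieAlgebra IG G))
    (A B C : Fin m) : ℝ :=
  -(e.repr ⁅e B, e C⁆ A)

variable {IG IP} {W : Set (Jet n r)}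

/-- A connection in a principal bundle: a smooth one-form on `P` with values in the Lie algebra
`T₁G` of `G` (which is the model space `EG` as a vector space), which reproduces the generators of
the vertical fields and is equivariant, `R_g^* ω̃ = Ad(g⁻¹) ω̃`. -/
structure Connection (Q : PrincipalBundle IG IP W G P) where
  form : OneForm IP P EG
  smooth : form.SmoothOn Set.univ
  vertical : ∀ (p : P) (a : GroupLieAlgebra IG G),
    form (Q.act p 1) (mfderiv IG IP (fun g : G => Q.act p g) 1 a) = a
  equivariant : ∀ (p : P) (g : G) (v : TangentSpace IP p),
    form (Q.act p g) (mfderiv IP IP (fun q : P => Q.act q g) p v) =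
      mfderiv IG IG (fun h : G => g⁻¹ * h * g) 1 (form p v)

variable {Q : PrincipalBundle IG IP W G P} [FiniteDimensional ℝ EG]

/-- The coordinate functional `e^A` on the Lie algebra of `G`. -/
def coordCLM {m : ℕ} (e : Module.Basis (Fin m) ℝ (GroupLieAlgebra IG G)) (A : Fin m) :
    EG →L[ℝ] ℝ :=
  LinearMap.toContinuousLinearMap (show EG →ₗ[ℝ] ℝ from e.coord A)

/-- The connection forms `ω̃^A`: the components of the connection with respect to a basis of the
Lie algebra. -/
def Connection.comp (Γ : Connection Q) {m : ℕ}
    (e : Module.Basis (Fin m) ℝ (GroupLieAlgebra IG G)) (A : Fin m) : OneForm IP P ℝ :=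
  fun p => (coordCLM e A).comp (Γ.form p)

/-- The curvature forms `Ω^A = dω̃^A - ½ C^A_{BC} ω̃^B ∧ ω̃^C` of the connection. -/
def Connection.curvature (Γ : Connection Q) {m : ℕ}
    (e : Module.Basis (Fin m) ℝ (GroupLieAlgebra IG G)) (A : Fin m)
    (p : P) (v w : TangentSpace IP p) : ℝ :=
  (Γ.comp e A).d p v w -
    (1 / 2) * ∑ B, ∑ C, structureConst IG e A B C * (Γ.comp e B).wedge (Γ.comp e C) p v w

/-! ### Restriction to the lift of a section, representations of zero curvature -/

/-- The tangent space at `p` of the part of `P` over the lifted section `x ↦ jʳu(x)`: the vectors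
whose projection to the jet bundle is tangent to the lifted section. (The first component of
`π(p) = jʳu(x)` is the point `x`.) -/
def PrincipalBundle.liftTangent (Q : PrincipalBundle IG IP W G P) (u : (Fin n → ℝ) → ℝ) (p : P) :
    Submodule ℝ (TangentSpace IP p) :=
  Submodule.comap
    (show TangentSpace IP p →ₗ[ℝ] Jet n r from
      (mfderiv IP 𝓘(ℝ, Jet n r) Q.proj p).toLinearMap)
    (LinearMap.range (fderiv ℝ (jetLift r u) (Q.proj p).1 : (Fin n → ℝ) →ₗ[ℝ] Jet n r))

/-- The part of `P` over the lift of the section `u` over `D`. -/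
def PrincipalBundle.overLift (Q : PrincipalBundle IG IP W G P) (D : Set (Fin n → ℝ))
    (u : (Fin n → ℝ) → ℝ) : Set P :=
  {p | ∃ x ∈ D, Q.proj p = jetLift r u x}

/-- The curvature forms vanish on the lift of the section `u` over `D`. -/
def Connection.CurvatureVanishesOn (Γ : Connection Q) {m : ℕ}
    (e : Module.Basis (Fin m) ℝ (GroupLieAlgebra IG G)) (D : Set (Fin n → ℝ))
    (u : (Fin n → ℝ) → ℝ) : Prop :=
  ∀ p ∈ Q.overLift D u, ∀ v ∈ Q.liftTangent u p, ∀ w ∈ Q.liftTangent u p,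
    ∀ A, Γ.curvature e A p v w = 0

/-- The connection determines a representation of zero curvature for the equation `F = 0`: the
curvature vanishes on the lifts of solutions, and only on these. -/
def Connection.IsZeroCurvatureRep (Γ : Connection Q) {m : ℕ}
    (e : Module.Basis (Fin m) ℝ (GroupLieAlgebra IG G)) (F : Jet n r → ℝ) : Prop :=
  ∀ (D : Set (Fin n → ℝ)) (u : (Fin n → ℝ) → ℝ), IsSection W D u →
    (Γ.CurvatureVanishesOn e D u ↔ IsSolution F D u)

/-! ### The associated bundle -/

/-- A representation of the Lie group `G` by transformations of an `N`-dimensional space with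
coordinates `X¹, …, Xᴺ` ranging over the open set `Y`, specified by its Pfaffian system
`dXᴵ - ξ_Aᴵ(X) w^A = 0`, where `w^A` are the left-invariant forms of `G`: the coefficients are
smooth and satisfy the Lie identities. -/
structure FibreRepresentation {m : ℕ} (e : Module.Basis (Fin m) ℝ (GroupLieAlgebra IG G))
    {N : ℕ} (Y : Set (Fin N → ℝ)) where
  /-- `ξ A X I` is `ξ_Aᴵ(X)` -/
  ξ : Fin m → (Fin N → ℝ) → Fin N → ℝ
  smooth : ∀ A, ContDiffOn ℝ ∞ (ξ A) Y
  lie_identities : ∀ X ∈ Y, ∀ (B C : Fin m) (I : Fin N),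
    ∑ K, ξ B X K * fderiv ℝ (fun Z => ξ C Z I) X (Pi.single K 1)
      - ∑ K, ξ C X K * fderiv ℝ (fun Z => ξ B Z I) X (Pi.single K 1)
      + ∑ A, ξ A X I * structureConst IG e A B C = 0

/-- `G` is effectively represented (up to a discrete kernel): the vector fields `ξ_A` on the fibre
are linearly independent over `ℝ`. -/
def FibreRepresentation.Effective {m : ℕ} {e : Module.Basis (Fin m) ℝ (GroupLieAlgebra IG G)}
    {N : ℕ} {Y : Set (Fin N → ℝ)} (R : FibreRepresentation e Y) : Prop :=
  ∀ c : Fin m → ℝ, (∀ X ∈ Y, ∀ I, ∑ A, c A * R.ξ A X I = 0) → ∀ A, c A = 0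

variable {m : ℕ} {e : Module.Basis (Fin m) ℝ (GroupLieAlgebra IG G)}
  {N : ℕ} {Y : Set (Fin N → ℝ)}

/-- The forms `θ̃ᴵ = dXᴵ - ξ_Aᴵ(X) ω̃^A` of the connection which is induced in the associated
bundle, expressed as forms in the point `p` of `P` and the fibre coordinates `X`. -/
def inducedForm (Γ : Connection Q) (R : FibreRepresentation e Y) (I : Fin N) :
    OneForm (IP.prod 𝓘(ℝ, Fin N → ℝ)) (P × (Fin N → ℝ)) ℝ :=
  fun q =>
    ((ContinuousLinearMap.proj I : (Fin N → ℝ) →L[ℝ] ℝ).comp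
        (ContinuousLinearMap.snd ℝ EP (Fin N → ℝ)) -
      ∑ A, R.ξ A q.2 I • (show EP →L[ℝ] ℝ from Γ.comp e A q.1).comp
        (ContinuousLinearMap.fst ℝ EP (Fin N → ℝ)) : EP × (Fin N → ℝ) →L[ℝ] ℝ)

/-- The induced Pfaffian system `θ̃¹, …, θ̃ᴺ` is completely integrable on the pull-back of the
section `u` over `D`, i.e. on the submanifold of all `(p, X)` with `p` over the lift of `u`. -/
def InducedSystemIntegrableOn (Γ : Connection Q) (R : FibreRepresentation e Y)
    (D : Set (Fin n → ℝ)) (u : (Fin n → ℝ) → ℝ) : Prop :=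
  CompletelyIntegrableOn (inducedForm Γ R) (Q.overLift D u ×ˢ Y)
    (fun q => Submodule.comap
      (ContinuousLinearMap.fst ℝ EP (Fin N → ℝ) : EP × (Fin N → ℝ) →ₗ[ℝ] EP)
      (Q.liftTangent u q.1))

end Bundles

end ZeroCurvature

end

/-! Everything follows from the structure equation dθ̃ᴵ = ∑_K θ̃ᴷ ∧ η_Kᴵ - ξ_Aᴵ Ω^A with η_Kᴵ =
-∂ξ_Aᴵ/∂Xᴷ ω̃^A (`inducedForm_d`). To obtain it, differentiate θ̃ᴵ = dXᴵ - ξ_Aᴵ ω̃^A, then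
substitute dXᴷ = θ̃ᴷ + ξ_Bᴷ ω̃^B and dω̃^A = Ω^A + ½ C^A_{BC} ω̃^B ∧ ω̃^C. The terms quadratic in ω̃
cancel exactly by the Lie identities (`induced_structure_identity`).

If the curvature vanishes on the lift of u, these η witness integrability. Conversely, evaluate any
integrability relation on horizontal lifts of two vectors: every θ̃ᴷ vanishes on them, so only
ξ_Aᴵ(X) Ω^A(v, w) = 0 survives, for every X in Y. The numbers Ω^A(v, w) do not depend on X, so
effectivity makes them zero. The zero curvature hypothesis translates vanishing curvature into F =
0.

The analytic work is to compute `OneForm.d` on P × ℝᴺ, which is defined through charts. -/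

noncomputable section

open scoped Topology

namespace ZeroCurvature

/-! ### One-forms in the charts of a manifold and of its product with a vector space. -/

section Charts
variable {E : Type*} [NormedAddCommGroup E] [NormedSpace ℝ E]
  {Q : Type*} [TopologicalSpace Q] [ChartedSpace E Q]
  {F : Type*} [NormedAddCommGroup F] [NormedSpace ℝ F]
  {V : Type*} [NormedAddCommGroup V] [NormedSpace ℝ V]

theorem mem_target_extChartAt_prod {q : Q × F} {y : E × F} :
    y ∈ (extChartAt (𝓘(ℝ, E).prod 𝓘(ℝ, F)) q).target ↔
      y.1 ∈ (extChartAt 𝓘(ℝ, E) q.1).target := by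
  rw [extChartAt_prod, PartialEquiv.prod_target, extChartAt_model_space_eq_id]
  simp only [Set.mem_prod, PartialEquiv.refl_target, Set.mem_univ, and_true]

theorem extChartAt_prod_symm_apply (q : Q × F) (y : E × F) :
    (extChartAt (𝓘(ℝ, E).prod 𝓘(ℝ, F)) q).symm y =
      ((extChartAt 𝓘(ℝ, E) q.1).symm y.1, y.2) := by
  rw [extChartAt_prod, extChartAt_model_space_eq_id]
  rfl

variable [IsManifold 𝓘(ℝ, E) ∞ Q]

theorem mdifferentiableAt_extChartAt_symm_of_mem {q : Q} {y : E}
    (hy : y ∈ (extChartAt 𝓘(ℝ, E) q).target) :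
    MDifferentiableAt 𝓘(ℝ, E) 𝓘(ℝ, E) (extChartAt 𝓘(ℝ, E) q).symm y :=
  ((contMDiffOn_extChartAt_symm (n := ∞) q).contMDiffAt
    ((isOpen_extChartAt_target q).mem_nhds hy)).mdifferentiableAt (by simp)

/-- Tangent vectors at a point are read in the preferred chart of that point, so this derivative is
that of a coordinate change whose target chart varies with `y`. -/
theorem mfderiv_extChartAt_symm_eq_fderiv {q : Q} {y : E}
    (hy : y ∈ (extChartAt 𝓘(ℝ, E) q).target) :
    mfderiv 𝓘(ℝ, E) 𝓘(ℝ, E) (extChartAt 𝓘(ℝ, E) q).symm y =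
      fderiv ℝ (extChartAt 𝓘(ℝ, E) ((extChartAt 𝓘(ℝ, E) q).symm y) ∘
        (extChartAt 𝓘(ℝ, E) q).symm) y := by
  rw [(mdifferentiableAt_extChartAt_symm_of_mem hy).mfderiv]
  change fderivWithin ℝ _ (Set.range id) y = _
  rw [Set.range_id, fderivWithin_univ]
  rfl

theorem mfderiv_extChartAt_symm_self (q : Q) :
    mfderiv 𝓘(ℝ, E) 𝓘(ℝ, E) (extChartAt 𝓘(ℝ, E) q).symm (extChartAt 𝓘(ℝ, E) q q) =
      ContinuousLinearMap.id ℝ E := by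
  rw [mfderiv_extChartAt_symm_eq_fderiv (mem_extChartAt_target q), extChartAt_to_inv]
  -- At the base point both charts are the one at `q`, so the coordinate change is the identity
  -- nearby.
  refine (Filter.EventuallyEq.fderiv_eq (f₁ := _) (f := id) ?_).trans fderiv_id
  filter_upwards [extChartAt_target_mem_nhds (I := 𝓘(ℝ, E)) q] with y hy
  exact (extChartAt 𝓘(ℝ, E) q).right_inv hy

theorem OneForm.inChart_extChartAt_self (α : OneForm 𝓘(ℝ, E) Q V) (q : Q) :
    α.inChart q (extChartAt 𝓘(ℝ, E) q q) = α q := by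
  unfold OneForm.inChart
  rw [mfderiv_extChartAt_symm_self]
  ext v
  change α ((extChartAt 𝓘(ℝ, E) q).symm (extChartAt 𝓘(ℝ, E) q q)) v = α q v
  rw [extChartAt_to_inv]

/-- The preferred charts of the product are chart × identity, so the coordinate change splits as
well. -/
theorem mfderiv_extChartAt_prod_symm {q : Q × F} {y : E × F}
    (hy : y.1 ∈ (extChartAt 𝓘(ℝ, E) q.1).target) :
    mfderiv 𝓘(ℝ, E × F) (𝓘(ℝ, E).prod 𝓘(ℝ, F))
        (extChartAt (𝓘(ℝ, E).prod 𝓘(ℝ, F)) q).symm y =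
      ContinuousLinearMap.prodMap
        (mfderiv 𝓘(ℝ, E) 𝓘(ℝ, E) (extChartAt 𝓘(ℝ, E) q.1).symm y.1 : E →L[ℝ] E)
        (ContinuousLinearMap.id ℝ F) := by
  have h1 := mdifferentiableAt_extChartAt_symm_of_mem hy
  have h2 : DifferentiableAt ℝ (extChartAt 𝓘(ℝ, E) ((extChartAt 𝓘(ℝ, E) q.1).symm y.1) ∘
        (extChartAt 𝓘(ℝ, E) q.1).symm) y.1 := by
    have h := ((mdifferentiableAt_iff _ _).1 h1).2
    change DifferentiableWithinAt ℝ _ (Set.range id) y.1 at h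
    rw [Set.range_id, differentiableWithinAt_univ] at h
    exact h
  have h3 : MDifferentiableAt 𝓘(ℝ, E × F) (𝓘(ℝ, E).prod 𝓘(ℝ, F))
        (extChartAt (𝓘(ℝ, E).prod 𝓘(ℝ, F)) q).symm y := by
    have h := contMDiffOn_extChartAt_symm (I := 𝓘(ℝ, E).prod 𝓘(ℝ, F)) (n := ∞)
      (M := Q × F) q
    exact (h.contMDiffAt ((isOpen_extChartAt_target (M := Q × F) q).mem_nhds
      (mem_target_extChartAt_prod.2 hy))).mdifferentiableAt (by simp)
  rw [h3.mfderiv, mfderiv_extChartAt_symm_eq_fderiv hy]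
  have h4 : HasFDerivAt (Prod.map (extChartAt 𝓘(ℝ, E) ((extChartAt 𝓘(ℝ, E) q.1).symm y.1) ∘
        (extChartAt 𝓘(ℝ, E) q.1).symm) (id : F → F)) _ y := h2.hasFDerivAt.prodMap y (hasFDerivAt_id y.2)
  refine Eq.trans ?_ h4.fderiv
  change fderivWithin ℝ _ (Set.range id) y = _
  rw [Set.range_id, fderivWithin_univ]
  refine congrArg (fun f => fderiv ℝ f y) (funext fun z => ?_)
  change extChartAt (𝓘(ℝ, E).prod 𝓘(ℝ, F)) ((extChartAt (𝓘(ℝ, E).prod 𝓘(ℝ, F)) q).symm y)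
    ((extChartAt (𝓘(ℝ, E).prod 𝓘(ℝ, F)) q).symm z) = _
  rw [extChartAt_prod_symm_apply, extChartAt_prod_symm_apply, extChartAt_prod,
    extChartAt_model_space_eq_id]
  rfl

theorem OneForm.inChart_prod (γ : OneForm (𝓘(ℝ, E).prod 𝓘(ℝ, F)) (Q × F) V) {q : Q × F} {y : E × F}
    (hy : y.1 ∈ (extChartAt 𝓘(ℝ, E) q.1).target) :
    γ.inChart q y = ContinuousLinearMap.comp
      (show E × F →L[ℝ] V from γ ((extChartAt 𝓘(ℝ, E) q.1).symm y.1, y.2))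
      (ContinuousLinearMap.prodMap
        (mfderiv 𝓘(ℝ, E) 𝓘(ℝ, E) (extChartAt 𝓘(ℝ, E) q.1).symm y.1 : E →L[ℝ] E)
        (ContinuousLinearMap.id ℝ F)) := by
  unfold OneForm.inChart
  rw [mfderiv_extChartAt_prod_symm hy]
  refine ContinuousLinearMap.ext fun v => ?_
  change γ ((extChartAt (𝓘(ℝ, E).prod 𝓘(ℝ, F)) q).symm y) _ = _
  rw [extChartAt_prod_symm_apply]
  rfl
end Charts

/-- The pointwise algebra behind the structure equation of the induced connection: `a`, `b` are the
values of the connection forms on two vectors, `x`, `y` the fibre components of these, `S A K` the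
derivatives `∂ξ_Aᴵ/∂Xᴷ`, and `D` the values of `dω̃^A`. -/
theorem induced_structure_identity {m N : ℕ} (ξ S : Fin m → Fin N → ℝ) (z a b D : Fin m → ℝ)
    (x y : Fin N → ℝ) (C : Fin m → Fin m → Fin m → ℝ)
    (hL : ∀ B C', ∑ K, ξ B K * S C' K - ∑ K, ξ C' K * S B K + ∑ A, z A * C A B C' = 0) :
    -∑ A, ((∑ K, x K * S A K) * b A - (∑ K, y K * S A K) * a A) - ∑ A, z A * D A =
      ∑ K, ((x K - ∑ A, ξ A K * a A) * (-∑ A, S A K * b A) -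
          (y K - ∑ A, ξ A K * b A) * (-∑ A, S A K * a A)) -
        ∑ A, z A * (D A - (1 / 2) * ∑ B, ∑ C', C A B C' * (a B * b C' - b B * a C')) := by
  have hcomm : ∀ (x : Fin N → ℝ) (b : Fin m → ℝ),
      ∑ K, x K * ∑ A, S A K * b A = ∑ A, (∑ K, x K * S A K) * b A := by
    intro x b
    simp_rw [Finset.mul_sum, Finset.sum_mul]
    rw [Finset.sum_comm]
    simp_rw [mul_assoc]
  have hquad : ∀ a b : Fin m → ℝ, ∑ K, (∑ A, ξ A K * a A) * ∑ A, S A K * b A =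
      ∑ B, ∑ A, (∑ K, ξ B K * S A K) * (a B * b A) := by
    intro a b
    rw [hcomm]
    simp_rw [Finset.sum_mul]
    rw [Finset.sum_comm' (t' := Finset.univ) (s' := fun _ => Finset.univ) (by simp)]
    simp_rw [Finset.sum_comm (s := (Finset.univ : Finset (Fin m)))
      (t := (Finset.univ : Finset (Fin N)))]
    refine Finset.sum_congr rfl fun K _ => ?_
    rw [Finset.sum_comm]
    refine Finset.sum_congr rfl fun B _ => Finset.sum_congr rfl fun A _ => ?_
    ring
  have hcurv : ∑ A, z A * ∑ B, ∑ C', C A B C' * (a B * b C' - b B * a C') =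
      ∑ B, ∑ C', (∑ A, z A * C A B C') * (a B * b C' - b B * a C') := by
    simp_rw [Finset.mul_sum, Finset.sum_mul]
    rw [Finset.sum_comm]
    refine Finset.sum_congr rfl fun B _ => ?_
    rw [Finset.sum_comm]
    refine Finset.sum_congr rfl fun C' _ => Finset.sum_congr rfl fun A _ => ?_
    ring
  -- `M B A` is the derivative of the coefficient ξ_Aᴵ along the field ξ_B; the Lie identities
  -- express its antisymmetric part through the structure constants.
  set M : Fin m → Fin m → ℝ := fun B A => ∑ K, ξ B K * S A K with hM
  have hswap : ∑ B, ∑ A, M A B * (a B * b A) = ∑ B, ∑ A, M B A * (b B * a A) := by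
    rw [Finset.sum_comm]
    refine Finset.sum_congr rfl fun B _ => Finset.sum_congr rfl fun A _ => ?_
    ring
  have hswap' : ∑ B, ∑ A, M A B * (b B * a A) = ∑ B, ∑ A, M B A * (a B * b A) := by
    rw [Finset.sum_comm]
    refine Finset.sum_congr rfl fun B _ => Finset.sum_congr rfl fun A _ => ?_
    ring
  have hT : ∀ B C', ∑ A, z A * C A B C' = M C' B - M B C' := fun B C' => by
    have := hL B C'
    simp only [hM]
    linarith
  -- Both antisymmetric halves contribute equally; the resulting factor 2 cancels the ½ in the
  -- curvature.
  have hcurv' : ∑ A, z A * ∑ B, ∑ C', C A B C' * (a B * b C' - b B * a C') =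
      2 * (∑ B, ∑ A, M B A * (b B * a A) - ∑ B, ∑ A, M B A * (a B * b A)) := by
    rw [hcurv]
    simp_rw [hT, sub_mul, mul_sub, Finset.sum_sub_distrib]
    rw [hswap, hswap']
    ring
  have e1 : ∑ K, ((x K - ∑ A, ξ A K * a A) * (-∑ A, S A K * b A) -
          (y K - ∑ A, ξ A K * b A) * (-∑ A, S A K * a A)) =
      -(∑ K, x K * ∑ A, S A K * b A) + ∑ K, y K * ∑ A, S A K * a A +
        ∑ K, (∑ A, ξ A K * a A) * (∑ A, S A K * b A) -
        ∑ K, (∑ A, ξ A K * b A) * (∑ A, S A K * a A) := by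
    rw [← Finset.sum_neg_distrib, ← Finset.sum_add_distrib, ← Finset.sum_add_distrib,
      ← Finset.sum_sub_distrib]
    exact Finset.sum_congr rfl fun K _ => by ring
  have e2 : ∑ A, z A * (D A - (1 / 2) * ∑ B, ∑ C', C A B C' * (a B * b C' - b B * a C')) =
      ∑ A, z A * D A -
        (1 / 2) * ∑ A, z A * ∑ B, ∑ C', C A B C' * (a B * b C' - b B * a C') := by
    rw [Finset.mul_sum, ← Finset.sum_sub_distrib]
    exact Finset.sum_congr rfl fun A _ => by ring
  rw [e1, e2, hcurv', hcomm, hcomm, hquad, hquad, Finset.sum_sub_distrib]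
  ring

/-! ### Smoothness and exterior derivative of the forms ℓ(dX) - c_A(X) α^A, a shape shared by θ̃ᴵ
and η_Kᴵ. -/

section Pullback
variable {E : Type*} [NormedAddCommGroup E] [NormedSpace ℝ E]
  {Q : Type*} [TopologicalSpace Q] [ChartedSpace E Q]
  {F : Type*} [NormedAddCommGroup F] [NormedSpace ℝ F] {ι : Type*} [Fintype ι]

theorem OneForm.SmoothOn.differentiableAt_inChart {α : OneForm 𝓘(ℝ, E) Q ℝ}
    (hα : α.SmoothOn Set.univ) (q : Q) :
    DifferentiableAt ℝ (α.inChart q) (extChartAt 𝓘(ℝ, E) q q) := by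
  refine ((hα q).contDiffAt ?_).differentiableAt (by simp)
  rw [Set.preimage_univ, Set.inter_univ]
  exact extChartAt_target_mem_nhds q

theorem sub_sum_smul_comp_fst_apply (ℓ : F →L[ℝ] ℝ) (c : ι → ℝ) (a : ι → E →L[ℝ] ℝ) (v : E × F) :
    (ℓ.comp (ContinuousLinearMap.snd ℝ E F) -
      ∑ A, c A • (a A).comp (ContinuousLinearMap.fst ℝ E F)) v = ℓ v.2 - ∑ A, c A * a A v.1 := by
  simp

/-- The form `ℓ(dX) - ∑_A c_A(X) α^A` on the product of a manifold with a vector space. -/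
def productForm (ℓ : F →L[ℝ] ℝ) (c : ι → F → ℝ) (α : ι → OneForm 𝓘(ℝ, E) Q ℝ) :
    OneForm (𝓘(ℝ, E).prod 𝓘(ℝ, F)) (Q × F) ℝ :=
  fun q => (ℓ.comp (ContinuousLinearMap.snd ℝ E F) -
    ∑ A, c A q.2 • (show E →L[ℝ] ℝ from α A q.1).comp (ContinuousLinearMap.fst ℝ E F) :
      E × F →L[ℝ] ℝ)

theorem productForm_apply (ℓ : F →L[ℝ] ℝ) (c : ι → F → ℝ) (α : ι → OneForm 𝓘(ℝ, E) Q ℝ)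
    (q : Q × F) (v : E × F) :
    productForm ℓ c α q v = ℓ v.2 - ∑ A, c A q.2 * α A q.1 v.1 :=
  sub_sum_smul_comp_fst_apply (E := E) ℓ (fun A => c A q.2) (fun A => α A q.1) v

variable [IsManifold 𝓘(ℝ, E) ∞ Q]

theorem productForm_inChart (ℓ : F →L[ℝ] ℝ) (c : ι → F → ℝ) (α : ι → OneForm 𝓘(ℝ, E) Q ℝ)
    {q : Q × F} {y : E × F} (hy : y.1 ∈ (extChartAt 𝓘(ℝ, E) q.1).target) :
    (productForm ℓ c α).inChart q y = ℓ.comp (ContinuousLinearMap.snd ℝ E F) -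
      ∑ A, c A y.2 • ((α A).inChart q.1 y.1).comp (ContinuousLinearMap.fst ℝ E F) := by
  rw [OneForm.inChart_prod _ hy]
  refine ContinuousLinearMap.ext fun v => ?_
  exact (productForm_apply ℓ c α _ _).trans
    (sub_sum_smul_comp_fst_apply ℓ (fun A => c A y.2) (fun A => (α A).inChart q.1 y.1) v).symm

theorem productForm_smoothOn (ℓ : F →L[ℝ] ℝ) {c : ι → F → ℝ} {α : ι → OneForm 𝓘(ℝ, E) Q ℝ}
    {Y : Set F} (hc : ∀ A, ContDiffOn ℝ ∞ (c A) Y) (hα : ∀ A, (α A).SmoothOn Set.univ) :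
    (productForm ℓ c α).SmoothOn (Set.univ ×ˢ Y) := by
  intro q
  have hmem : ∀ y ∈ (extChartAt (𝓘(ℝ, E).prod 𝓘(ℝ, F)) q).target ∩
      (extChartAt (𝓘(ℝ, E).prod 𝓘(ℝ, F)) q).symm ⁻¹' (Set.univ ×ˢ Y),
      y.1 ∈ (extChartAt 𝓘(ℝ, E) q.1).target ∧ y.2 ∈ Y := by
    rintro y ⟨hy, hY⟩
    rw [Set.mem_preimage, extChartAt_prod_symm_apply] at hY
    exact ⟨mem_target_extChartAt_prod.1 hy, hY.2⟩
  refine ContDiffOn.congr ?_ fun y hy => productForm_inChart ℓ c α (hmem y hy).1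
  refine contDiffOn_const.sub (ContDiffOn.sum fun A _ => ContDiffOn.fun_smul ?_ ?_)
  · exact (hc A).comp contDiffOn_snd fun y hy => (hmem y hy).2
  · refine ContDiffOn.clm_comp (ContDiffOn.comp (hα A q.1) contDiffOn_fst fun y hy => ?_)
      contDiffOn_const
    exact ⟨(hmem y hy).1, trivial⟩

/-- This is d(cα) = dc ∧ α + c dα: the product chart separates the variables, and ℓ(dX) has constant
coefficients there, hence is closed. -/
theorem productForm_d (ℓ : F →L[ℝ] ℝ) {c : ι → F → ℝ} {α : ι → OneForm 𝓘(ℝ, E) Q ℝ}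
    {q : Q × F} (hc : ∀ A, DifferentiableAt ℝ (c A) q.2) (hα : ∀ A, (α A).SmoothOn Set.univ)
    (v w : E × F) :
    (productForm ℓ c α).d q v w =
      -∑ A, (fderiv ℝ (c A) q.2 v.2 * α A q.1 w.1 - fderiv ℝ (c A) q.2 w.2 * α A q.1 v.1) -
        ∑ A, c A q.2 * (α A).d q.1 v.1 w.1 := by
  set y₀ : E × F := (extChartAt 𝓘(ℝ, E) q.1 q.1, q.2) with hy₀
  have hbase : extChartAt (𝓘(ℝ, E).prod 𝓘(ℝ, F)) q q = y₀ := by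
    rw [extChartAt_prod, extChartAt_model_space_eq_id]
    rfl
  have hev : (productForm ℓ c α).inChart q =ᶠ[𝓝 y₀] fun y =>
      ℓ.comp (ContinuousLinearMap.snd ℝ E F) -
        ∑ A, c A y.2 • ((α A).inChart q.1 y.1).comp (ContinuousLinearMap.fst ℝ E F) := by
    have : (fun y : E × F => y.1) ⁻¹' (extChartAt 𝓘(ℝ, E) q.1).target ∈ 𝓝 y₀ :=
      continuous_fst.continuousAt.preimage_mem_nhds
        (extChartAt_target_mem_nhds (I := 𝓘(ℝ, E)) q.1)
    filter_upwards [this] with y hy using productForm_inChart ℓ c α hy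
  have hd : ∀ A, DifferentiableAt ℝ ((α A).inChart q.1) y₀.1 :=
    fun A => (hα A).differentiableAt_inChart q.1
  have hder : ∀ v w : E × F, fderiv ℝ ((productForm ℓ c α).inChart q) y₀ v w =
      -∑ A, (fderiv ℝ (c A) q.2 v.2 * α A q.1 w.1 +
        c A q.2 * fderiv ℝ ((α A).inChart q.1) y₀.1 v.1 w.1) := by
    intro v w
    rw [hev.fderiv_eq]
    have h1 : ∀ A, HasFDerivAt (fun y : E × F => c A y.2)
        ((fderiv ℝ (c A) q.2).comp (ContinuousLinearMap.snd ℝ E F)) y₀ := fun A =>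
      (hc A).hasFDerivAt.comp (f := Prod.snd) y₀ hasFDerivAt_snd
    have h2 : ∀ A, HasFDerivAt (fun y : E × F => (α A).inChart q.1 y.1)
        ((fderiv ℝ ((α A).inChart q.1) y₀.1).comp (ContinuousLinearMap.fst ℝ E F)) y₀ := fun A =>
      (hd A).hasFDerivAt.comp (f := Prod.fst) y₀ hasFDerivAt_fst
    have h3 := (hasFDerivAt_const (ℓ.comp (ContinuousLinearMap.snd ℝ E F)) y₀).sub
      (HasFDerivAt.fun_sum (u := Finset.univ) fun A _ =>
        (h1 A).smul ((h2 A).clm_comp (hasFDerivAt_const (ContinuousLinearMap.fst ℝ E F) y₀)))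
    erw [h3.fderiv]
    -- The undifferentiated factor is evaluated at the base point of the chart, where a form agrees
    -- with its chart expression.
    have hα₀ : ∀ A, (α A).inChart q.1 y₀.1 = α A q.1 :=
      fun A => OneForm.inChart_extChartAt_self (α A) q.1
    simp only [zero_sub, neg_apply, sum_apply]
    congr 1
    refine Finset.sum_congr rfl fun A _ => ?_
    rw [← hα₀ A]
    simp [y₀]
    exact add_comm _ _
  have hexp : (productForm ℓ c α).d q v w =
      fderiv ℝ ((productForm ℓ c α).inChart q) y₀ v w -
        fderiv ℝ ((productForm ℓ c α).inChart q) y₀ w v := by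
    unfold OneForm.d
    rw [hbase]
  rw [hexp, hder, hder]
  simp only [OneForm.d, Finset.sum_add_distrib, Finset.sum_sub_distrib, mul_sub]
  ring
end Pullback

/-! ### The structure equation of the induced connection and its two consequences. -/

section Induced
variable {n r m N : ℕ}
    {EG : Type*} [NormedAddCommGroup EG] [NormedSpace ℝ EG]
    {G : Type*} [TopologicalSpace G] [ChartedSpace EG G] [Group G]
    {EP : Type*} [NormedAddCommGroup EP] [NormedSpace ℝ EP]
    {P : Type*} [TopologicalSpace P] [ChartedSpace EP P]
    {W : Set (Jet n r)} {Q : PrincipalBundle 𝓘(ℝ, EG) 𝓘(ℝ, EP) W G P}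
    {e : Module.Basis (Fin m) ℝ (GroupLieAlgebra 𝓘(ℝ, EG) G)}
    {Y : Set (Fin N → ℝ)}

theorem FibreRepresentation.contDiffOn_coeff (R : FibreRepresentation e Y) (A : Fin m)
    (I : Fin N) : ContDiffOn ℝ ∞ (fun X => R.ξ A X I) Y :=
  contDiffOn_pi.1 (R.smooth A) I

variable [FiniteDimensional ℝ EG]

theorem Connection.comp_smoothOn (Γ : Connection Q)
    (e : Module.Basis (Fin m) ℝ (GroupLieAlgebra 𝓘(ℝ, EG) G)) (A : Fin m) :
    (Γ.comp e A).SmoothOn Set.univ := fun q =>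
  (contDiffOn_const (c := coordCLM e A)).clm_comp (Γ.smooth q)

theorem inducedForm_eq_productForm (Γ : Connection Q) (R : FibreRepresentation e Y) (I : Fin N) :
    inducedForm Γ R I =
      productForm (ContinuousLinearMap.proj I) (fun A X => R.ξ A X I) (Γ.comp e) :=
  rfl

/-- The forms `η_Kᴵ = -∂ξ_Aᴵ/∂Xᴷ ω̃^A`, here indexed as `inducedCoeff Γ R K I`. -/
def inducedCoeff (Γ : Connection Q) (R : FibreRepresentation e Y) (K I : Fin N) :
    OneForm (𝓘(ℝ, EP).prod 𝓘(ℝ, Fin N → ℝ)) (P × (Fin N → ℝ)) ℝ :=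
  productForm 0 (fun A X => fderiv ℝ (fun Z => R.ξ A Z I) X (Pi.single K 1)) (Γ.comp e)

theorem inducedForm_apply (Γ : Connection Q) (R : FibreRepresentation e Y) (I : Fin N)
    (q : P × (Fin N → ℝ)) (v : EP × (Fin N → ℝ)) :
    inducedForm Γ R I q v = v.2 I - ∑ A, R.ξ A q.2 I * Γ.comp e A q.1 v.1 := by
  rw [inducedForm_eq_productForm]
  exact productForm_apply _ _ _ q v

theorem inducedCoeff_apply (Γ : Connection Q) (R : FibreRepresentation e Y) (K I : Fin N)
    (q : P × (Fin N → ℝ)) (v : EP × (Fin N → ℝ)) :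
    inducedCoeff Γ R K I q v =
      -∑ A, fderiv ℝ (fun Z => R.ξ A Z I) q.2 (Pi.single K 1) * Γ.comp e A q.1 v.1 := by
  rw [inducedCoeff]
  exact (productForm_apply _ _ _ q v).trans (zero_sub _)

theorem fderiv_eq_sum_single {f : (Fin N → ℝ) → ℝ} (X v : Fin N → ℝ) :
    fderiv ℝ f X v = ∑ K, v K * fderiv ℝ f X (Pi.single K 1) := by
  have h := LinearMap.pi_apply_eq_sum_univ (fderiv ℝ f X : (Fin N → ℝ) →ₗ[ℝ] ℝ) v
  simp only [ContinuousLinearMap.coe_coe, smul_eq_mul] at h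
  rw [h]
  refine Finset.sum_congr rfl fun K _ => ?_
  congr 2
  ext i
  simp [Pi.single_apply, eq_comm]

variable [IsManifold 𝓘(ℝ, EP) ∞ P]

theorem inducedCoeff_smoothOn (Γ : Connection Q) (R : FibreRepresentation e Y) (hY : IsOpen Y)
    (K I : Fin N) : (inducedCoeff Γ R K I).SmoothOn (Set.univ ×ˢ Y) :=
  productForm_smoothOn 0
    (fun A => ((R.contDiffOn_coeff A I).fderiv_of_isOpen hY (by simp)).clm_apply
      contDiffOn_const)
    (Γ.comp_smoothOn e)

/-- The structure equation `dθ̃ᴵ = ∑_K θ̃ᴷ ∧ η_Kᴵ - ξ_Aᴵ Ω^A` of the induced connection. -/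
theorem inducedForm_d (Γ : Connection Q) (R : FibreRepresentation e Y) (hY : IsOpen Y)
    {q : P × (Fin N → ℝ)} (hq : q.2 ∈ Y) (I : Fin N) (v w : EP × (Fin N → ℝ)) :
    (inducedForm Γ R I).d q v w =
      ∑ K, (inducedForm Γ R K).wedge (inducedCoeff Γ R K I) q v w -
        ∑ A, R.ξ A q.2 I * Γ.curvature e A q.1 v.1 w.1 := by
  have hdiff : ∀ A, DifferentiableAt ℝ (fun X => R.ξ A X I) q.2 := fun A =>
    ((R.contDiffOn_coeff A I).contDiffAt (hY.mem_nhds hq)).differentiableAt (by simp)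
  rw [inducedForm_eq_productForm, productForm_d _ hdiff (Γ.comp_smoothOn e)]
  simp only [OneForm.wedge]
  refine Eq.trans ?_ ((induced_structure_identity (fun A => R.ξ A q.2)
    (fun A K => fderiv ℝ (fun Z => R.ξ A Z I) q.2 (Pi.single K 1)) (fun A => R.ξ A q.2 I)
    (fun A => Γ.comp e A q.1 v.1) (fun A => Γ.comp e A q.1 w.1)
    (fun A => (Γ.comp e A).d q.1 v.1 w.1) v.2 w.2 (structureConst 𝓘(ℝ, EG) e)
    (fun B C => R.lie_identities q.2 hq B C I)).trans ?_)
  · congr 2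
    refine Finset.sum_congr rfl fun A _ => ?_
    -- Directional derivatives of ξ_Aᴵ along the fibre become sums of the partials in the Lie
    -- identities.
    rw [fderiv_eq_sum_single q.2 v.2, fderiv_eq_sum_single q.2 w.2]
  · congr 1
    refine Finset.sum_congr rfl fun K _ => ?_
    rw [← inducedForm_apply Γ R K q v, ← inducedForm_apply Γ R K q w,
      ← inducedCoeff_apply Γ R K I q v, ← inducedCoeff_apply Γ R K I q w]

theorem inducedSystemIntegrableOn_of_curvatureVanishesOn {Γ : Connection Q}
    (R : FibreRepresentation e Y) (hY : IsOpen Y) {D : Set (Fin n → ℝ)} {u : (Fin n → ℝ) → ℝ}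
    (h : Γ.CurvatureVanishesOn e D u) : InducedSystemIntegrableOn Γ R D u := by
  -- The η of the structure equation are smooth on all of P × Y, so no smaller neighbourhood is
  -- needed.
  refine ⟨inducedCoeff Γ R, Set.univ ×ˢ Y, isOpen_univ.prod hY,
    Set.prod_mono (Set.subset_univ _) subset_rfl, inducedCoeff_smoothOn Γ R hY, ?_⟩
  intro q hq v hv w hw I
  refine (inducedForm_d Γ R hY hq.2 I v w).trans ?_
  rw [Finset.sum_eq_zero (f := fun A => R.ξ A q.2 I * _) fun A _ => ?_, sub_zero]
  exact mul_eq_zero_of_right _ (h q.1 hq.1 v.1 hv w.1 hw A)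

theorem curvatureVanishesOn_of_inducedSystemIntegrableOn {Γ : Connection Q}
    {R : FibreRepresentation e Y} (hR : R.Effective) (hY : IsOpen Y) {D : Set (Fin n → ℝ)}
    {u : (Fin n → ℝ) → ℝ} (h : InducedSystemIntegrableOn Γ R D u) :
    Γ.CurvatureVanishesOn e D u := by
  obtain ⟨η, O, -, -, -, hη⟩ := h
  intro p hp v hv w hw
  -- With p, v, w fixed, the curvature values are constants, the coefficients of a linear relation
  -- among the fields ξ_A on Y.
  refine hR (fun A => Γ.curvature e A p v w) fun X hX I => ?_
  -- Horizontal lifts of `v` and `w`, on which all `θ̃ᴷ` vanish.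
  let lift : EP → EP × (Fin N → ℝ) := fun z => (z, fun K => ∑ A, R.ξ A X K * Γ.comp e A p z)
  have hlift : ∀ z K, inducedForm Γ R K (p, X) (lift z) = 0 := fun z K =>
    (inducedForm_apply Γ R K (p, X) (lift z)).trans (sub_self _)
  have hwedge : ∀ K (β : OneForm (𝓘(ℝ, EP).prod 𝓘(ℝ, Fin N → ℝ)) (P × (Fin N → ℝ)) ℝ),
      (inducedForm Γ R K).wedge β (p, X) (lift v) (lift w) = 0 := fun K β =>
    (congrArg₂ (· - ·) (mul_eq_zero_of_left (hlift v K) _)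
      (mul_eq_zero_of_left (hlift w K) _)).trans (sub_zero 0)
  -- Two expressions for dθ̃ᴵ on the lifts are equated, one with the explicit η and one with the
  -- given η; both wedge sums vanish there, leaving the curvature term.
  have h := (inducedForm_d Γ R hY (q := (p, X)) hX I (lift v) (lift w)).symm.trans
    (hη (p, X) ⟨hp, hX⟩ (lift v) hv (lift w) hw I)
  rw [Finset.sum_eq_zero fun K _ => hwedge K _, Finset.sum_eq_zero fun K _ => hwedge K _,
    zero_sub, neg_eq_zero] at h
  exact (Finset.sum_congr rfl fun A _ => mul_comm _ _).trans h

end Induced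

end ZeroCurvature

end

theorem corollary4p1 {n r m N : ℕ}
    {EG : Type*} [NormedAddCommGroup EG] [NormedSpace ℝ EG] [FiniteDimensional ℝ EG]
    {G : Type*} [TopologicalSpace G] [ChartedSpace EG G] [Group G] [LieGroup 𝓘(ℝ, EG) ∞ G]
    {EP : Type*} [NormedAddCommGroup EP] [NormedSpace ℝ EP] [FiniteDimensional ℝ EP]
    {P : Type*} [TopologicalSpace P] [ChartedSpace EP P] [IsManifold 𝓘(ℝ, EP) ∞ P]
    {W : Set (ZeroCurvature.Jet n r)} (hW : IsOpen W)
    (Q : ZeroCurvature.PrincipalBundle 𝓘(ℝ, EG) 𝓘(ℝ, EP) W G P)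
    (e : Module.Basis (Fin m) ℝ (GroupLieAlgebra 𝓘(ℝ, EG) G))
    (Γ : ZeroCurvature.Connection Q)
    (F : ZeroCurvature.Jet n r → ℝ) (hF : Γ.IsZeroCurvatureRep e F)
    {Y : Set (Fin N → ℝ)} (hY : IsOpen Y)
    (R : ZeroCurvature.FibreRepresentation e Y) :
    (∀ (D : Set (Fin n → ℝ)) (u : (Fin n → ℝ) → ℝ), ZeroCurvature.IsSection W D u →
      ZeroCurvature.IsSolution F D u → ZeroCurvature.InducedSystemIntegrableOn Γ R D u) ∧
    (R.Effective →
      ∀ (D : Set (Fin n → ℝ)) (u : (Fin n → ℝ) → ℝ), ZeroCurvature.IsSection W D u →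
        (ZeroCurvature.InducedSystemIntegrableOn Γ R D u ↔ ZeroCurvature.IsSolution F D u)) := by
  refine ⟨fun D u hu h =>
      ZeroCurvature.inducedSystemIntegrableOn_of_curvatureVanishesOn R hY ((hF D u hu).2 h),
    fun hR D u hu => ⟨fun h => (hF D u hu).1
        (ZeroCurvature.curvatureVanishesOn_of_inducedSystemIntegrableOn hR hY h),
      fun h => ZeroCurvature.inducedSystemIntegrableOn_of_curvatureVanishesOn R hY
        ((hF D u hu).2 h)⟩⟩
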